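/- **Definitions.** Let $x=(x_1,\dots,x_n)$, where $x_i$ ranges over a set $R_i\subseteq\mathbb R$ carrying a measure $M_i$, and let $f$ be a finite tuple of non-negative univariate functions $f_{i,j}$ ($1\le i\le n$, $1\le j\le m_i$), each $f_{i,j}$ being a function of $x_i$ with finite $M_i$-integral. A *sum product network (SPN) over $f$* is a monotone arithmetic circuit over $f$: a finite directed acyclic graph with a single node without outgoing edges (the root), whose nodes of in-degree $0$ are labelled by some $f_{i,j}$ or by a non-negative real constant, and whose other nodes are labelled $\times$ or $+$ (with arbitrary fan-in), the edges into $+$ nodes carrying non-negative real weights. A node computes its label, the product of its children, or the weighted sum of its children, respectively; the output $q_\Phi(f)$ of the SPN $\Phi$ is what its root computes, and $\Phi$ computes the function $x\mapsto q_\Phi(f(x))$. The *dependency-scope* of a node $u$ is the set of those $x_i$ such that some $f_{i,j}$ labels a node of the subcircuit rooted at $u$. The SPN is *D&C* (decomposable and complete) if the dependency-scopes of distinct children of a $\times$ node are always disjoint, and the dependency-scopes of the children of a $+$ node are always equal. The *size* is the number of nodes, and the *depth* is the length (number of edges) of the longest directed path. **Corollary (depth reduction).** 1. There is an absolute constant $C$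 such that for every $n\ge 2$, every choice of $R_i$, $M_i$ and $f$ as above, and every D&C SPN $\Phi$ over $f$ of size $s$ (and arbitrary depth), there is a D&C SPN $\Phi'$ over the same $f$ which computes the same function, both as a function $q_{\Phi'}(y)=q_\Phi(y)$ of real values $y$ substituted for the tuple $f$ and as a function $q_{\Phi'}(f(x))=q_\Phi(f(x))$ of $x$, and which has size at most $C s^3$ and depth at most $C\log(n)\log(s)$. 2. Hence, for polynomial size, depth beyond $O(\log(n)^2)$ adds no expressive efficiency: for every sequence (indexed by $n$) of data $R_i$, $M_i$, $f$ as above in $n$ variables and every sequence of functions $g_n(x_1,\dots,x_n)$, the $g_n$ are computed by D&C SPNs $\Phi_n$ over the given functions of size polynomially bounded in $n$ (and of arbitrary depth) if and only if they are computed by such D&C SPNs of size polynomially bounded in $n$ and depth $O(\log(n)^2)$. -/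

import Mathlib

/-- The label of a node of an arithmetic circuit over variables indexed by `ι`. -/
inductive NodeLabel (ι : Type) where
  | var (i : ι)
  | const (c : ℝ)
  | sum
  | prod

/-- An arithmetic circuit over the variables indexed by `ι`: a finite directed acyclic graph with
unbounded fan-in. `children u` is the set of nodes with an edge into `u`. The nodes of in-degree `0`
are exactly those labelled by a variable or a real constant. `weight v u` is the weight of the edge
from `v` to `u`; it is only used if `u` is a sum node and `v` is a child of `u`. The root is the
unique node without outgoing edges. -/
structure ArithmeticCircuit (ι : Type) where
  V : Type
  fintypeV : Fintype V
  label : V → NodeLabel ι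
  children : V → Finset V
  weight : V → V → ℝ
  root : V
  acyclic : ∀ v, ¬ Relation.TransGen (fun a b => a ∈ children b) v v
  leaf_iff : ∀ v, children v = ∅ ↔ (∃ i, label v = NodeLabel.var i) ∨ ∃ c, label v = NodeLabel.const c
  root_iff : ∀ v, (∀ u, v ∉ children u) ↔ v = root

namespace ArithmeticCircuit

attribute [instance] ArithmeticCircuit.fintypeV

variable {ι : Type} (C : ArithmeticCircuit ι)

/-- There is an edge from `a` to `b`. -/
def Edge (a b : C.V) : Prop := a ∈ C.children b

theorem wellFounded_edge : WellFounded C.Edge := by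
  have : Std.Irrefl (Relation.TransGen C.Edge) := ⟨C.acyclic⟩
  have h : WellFounded (Relation.TransGen C.Edge) :=
    Finite.wellFounded_of_trans_of_irrefl _
  exact Subrelation.wf (fun h => Relation.TransGen.single h) h

/-- The value computed by each node when the variables take the values `y`. -/
noncomputable def eval (y : ι → ℝ) : C.V → ℝ :=
  C.wellFounded_edge.fix fun u rec =>
    match C.label u with
    | NodeLabel.var i => y i
    | NodeLabel.const c => c
    | NodeLabel.sum => ∑ v ∈ (C.children u).attach, C.weight v.1 u * rec v.1 v.2
    | NodeLabel.prod => ∏ v ∈ (C.children u).attach, rec v.1 v.2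

theorem eval_eq (y : ι → ℝ) (u : C.V) :
    C.eval y u =
      match C.label u with
      | NodeLabel.var i => y i
      | NodeLabel.const c => c
      | NodeLabel.sum => ∑ v ∈ C.children u, C.weight v u * C.eval y v
      | NodeLabel.prod => ∏ v ∈ C.children u, C.eval y v := by
  have h := C.wellFounded_edge.fix_eq (C := fun _ => ℝ) (fun u rec =>
    match C.label u with
    | NodeLabel.var i => y i
    | NodeLabel.const c => c
    | NodeLabel.sum => ∑ v ∈ (C.children u).attach, C.weight v.1 u * rec v.1 v.2
    | NodeLabel.prod => ∏ v ∈ (C.children u).attach, rec v.1 v.2) u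
  refine (show C.eval y u = _ from h).trans ?_
  cases C.label u with
  | var i => rfl
  | const c => rfl
  | sum => exact Finset.sum_attach (C.children u) (fun v => C.weight v u * C.eval y v)
  | prod => exact Finset.prod_attach (C.children u) (fun v => C.eval y v)

/-- The output of the circuit: the value computed by its root. -/
noncomputable def output (y : ι → ℝ) : ℝ := C.eval y C.root

/-- All weights and constants are non-negative. -/
def IsMonotone : Prop :=
  (∀ u c, C.label u = NodeLabel.const c → 0 ≤ c) ∧
    ∀ u, C.label u = NodeLabel.sum → ∀ v ∈ C.children u, 0 ≤ C.weight v u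

/-- The scope of `u`: the variables that label nodes of the subcircuit rooted at `u`. -/
def scope (u : C.V) : Set ι :=
  {i | ∃ v, Relation.ReflTransGen C.Edge v u ∧ C.label v = NodeLabel.var i}

/-- The number of nodes. -/
def size : ℕ := Fintype.card C.V

/-- The lengths (numbers of edges) of the directed paths of the circuit. -/
def pathLengths : Set ℕ :=
  {k | ∃ p : List C.V, p.IsChain C.Edge ∧ p.length = k + 1}

/-- The length of the longest directed path. -/
noncomputable def depth : ℕ := sSup C.pathLengths

theorem isGreatest_depth : IsGreatest C.pathLengths C.depth := by
  have hne : C.pathLengths.Nonempty := ⟨0, [C.root], by simp, rfl⟩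
  have hb : BddAbove C.pathLengths := by
    refine ⟨Fintype.card C.V, ?_⟩
    rintro k ⟨p, hp, hk⟩
    have h1 : p.IsChain (Relation.TransGen C.Edge) :=
      hp.imp fun _ _ h => Relation.TransGen.single h
    have h2 : p.Nodup := h1.pairwise.imp fun {a b} h => by
      rintro rfl
      exact C.acyclic a h
    have := h2.length_le_card
    omega
  exact ⟨Nat.sSup_mem hne hb, fun k hk => le_csSup hb hk⟩

end ArithmeticCircuit

/-- The data over which an SPN in `n` variables is built: for each `i`, a range `R i ⊆ ℝ` of the
variable `x i`, a measure on it, and finitely many non-negative functions of `x i` alone with finite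
integral. -/
structure UnivariateData (n : ℕ) where
  R : Fin n → Set ℝ
  M : (i : Fin n) → MeasureTheory.Measure (R i)
  m : Fin n → ℕ
  f : (i : Fin n) → Fin (m i) → R i → ℝ
  f_nonneg : ∀ i j t, 0 ≤ f i j t
  f_integrable : ∀ i j, MeasureTheory.Integrable (f i j) (M i)

namespace UnivariateData

variable {n : ℕ} (F : UnivariateData n)

/-- The index set of the tuple of all the univariate functions. -/
abbrev Idx : Type := (i : Fin n) × Fin (F.m i)

/-- The possible values of `x = (x 1, …, x n)`. -/
abbrev Point : Type := (i : Fin n) → F.R i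

/-- The values of all the univariate functions at `x`. -/
def apply (x : F.Point) : F.Idx → ℝ := fun p => F.f p.1 p.2 (x p.1)

end UnivariateData

/-- A sum product network: a monotone arithmetic circuit over the univariate functions. -/
structure SPN {n : ℕ} (F : UnivariateData n) extends ArithmeticCircuit F.Idx where
  monotone : toArithmeticCircuit.IsMonotone

namespace SPN

variable {n : ℕ} {F : UnivariateData n} (Φ : SPN F)

/-- The function of `x` computed by the SPN. -/
noncomputable def value (x : F.Point) : ℝ := Φ.output (F.apply x)

/-- The set of the variables `x i` on which the members of the scope of `u` depend. -/
def dependencyScope (u : Φ.V) : Set (Fin n) := Sigma.fst '' Φ.scope u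

def IsDecomposable : Prop :=
  ∀ u, Φ.label u = NodeLabel.prod → ∀ v ∈ Φ.children u, ∀ w ∈ Φ.children u, v ≠ w →
    Disjoint (Φ.dependencyScope v) (Φ.dependencyScope w)

def IsComplete : Prop :=
  ∀ u, Φ.label u = NodeLabel.sum → ∀ v ∈ Φ.children u, ∀ w ∈ Φ.children u,
    Φ.dependencyScope v = Φ.dependencyScope w

/-- A D&C SPN: decomposable and complete. -/
def IsDC : Prop := Φ.IsDecomposable ∧ Φ.IsComplete

end SPN

/-- `Φ` is a family of D&C SPNs of polynomial size that computes the functions `g n`. -/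
def IsPolySizeDCFamily (F : (n : ℕ) → UnivariateData n) (g : (n : ℕ) → (F n).Point → ℝ)
    (Φ : (n : ℕ) → SPN (F n)) : Prop :=
  (∀ n, (Φ n).IsDC ∧ ∀ x, (Φ n).value x = g n x) ∧
    ∃ k : ℕ, Asymptotics.IsBigO Filter.atTop (fun n => ((Φ n).size : ℝ)) (fun n => (n : ℝ) ^ k)

/-! This is the balancing method of Valiant, Skyum, Berkowitz and Rackoff, with the number of
variables in the dependency-scope `D u` in the role of the degree. If `D v` is non-empty,
decomposability lets `v` enter a product through at most one child, so `v` occurs at most once in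
every parse tree of `u`. Hence `u` has a formal derivative u/v (`quotient y v u`), with scope `D u \
D v`.

Let t run over the nodes where the scope first exceeds half of that of u. Then u = Σ (u/t)·t
(`eval_eq_sum_frontier`). Here u/t has less than half of the variables of u, and if t is a product,
so that t expands into its children, each child has at most half. Likewise u/v = Σ (u/t)(t/v)
(`quotient_eq_sum_frontier`), where t is a product whose scope first exceeds the midpoint between |D
v| and |D u|. There t/v is c/v times the siblings of c, for the one child c above v. Both u/t and
c/v have at most half of the variables of u/v. A sibling has at most as many as u/v, and its own
expansion then halves them.

One node for each u, pair or triple gives at most 5s³ nodes. Fan-in is unbounded, so each halving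
costs boundedly many layers, and the depth is at most `4 * n.size + 1`, which is O(log n). The
factor log s only has to be bounded below when s ≥ 2; a circuit with s = 1 already has depth 0. Part
2 follows because log s = O(log n) for polynomial s. -/

namespace ArithmeticCircuit

/-- `v` is a node of the subcircuit rooted at `u`. -/
def Below {ι : Type} (C : ArithmeticCircuit ι) (v u : C.V) : Prop :=
  Relation.ReflTransGen C.Edge v u

/-! ### Evaluation and reachability in a circuit -/

section Basic

variable {ι : Type} {C : ArithmeticCircuit ι}

theorem Below.refl (u : C.V) : C.Below u u := Relation.ReflTransGen.refl

theorem Below.trans {u v w : C.V} (h : C.Below u v) (h' : C.Below v w) : C.Below u w :=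
  Relation.ReflTransGen.trans h h'

theorem Below.of_mem {u c : C.V} (h : c ∈ C.children u) : C.Below c u :=
  Relation.ReflTransGen.single h

theorem Below.eq_or_exists {v u : C.V} (h : C.Below v u) :
    u = v ∨ ∃ c ∈ C.children u, C.Below v c := by
  rcases Relation.ReflTransGen.cases_tail h with h | ⟨c, h1, h2⟩
  · exact Or.inl h
  · exact Or.inr ⟨c, h2, h1⟩

theorem children_nonempty_of_sum {u : C.V} (h : C.label u = .sum) : (C.children u).Nonempty := by
  rw [Finset.nonempty_iff_ne_empty, Ne, C.leaf_iff, h]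
  simp

theorem children_eq_empty_of_var {u : C.V} {i : ι} (h : C.label u = .var i) : C.children u = ∅ :=
  (C.leaf_iff u).2 (Or.inl ⟨i, h⟩)

theorem children_eq_empty_of_const {u : C.V} {a : ℝ} (h : C.label u = .const a) :
    C.children u = ∅ :=
  (C.leaf_iff u).2 (Or.inr ⟨a, h⟩)

theorem eval_var (y : ι → ℝ) {u : C.V} {i : ι} (h : C.label u = .var i) : C.eval y u = y i := by
  rw [eval_eq, h]

theorem eval_const (y : ι → ℝ) {u : C.V} {a : ℝ} (h : C.label u = .const a) : C.eval y u = a := by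
  rw [eval_eq, h]

theorem eval_sum (y : ι → ℝ) {u : C.V} (h : C.label u = .sum) :
    C.eval y u = ∑ c ∈ C.children u, C.weight c u * C.eval y c := by
  rw [eval_eq, h]

theorem eval_prod (y : ι → ℝ) {u : C.V} (h : C.label u = .prod) :
    C.eval y u = ∏ c ∈ C.children u, C.eval y c := by
  rw [eval_eq, h]

theorem eval_nonneg (hC : C.IsMonotone) {y : ι → ℝ} (hy : ∀ i, 0 ≤ y i) (u : C.V) :
    0 ≤ C.eval y u := by
  induction u using C.wellFounded_edge.induction with
  | _ u ih =>
    cases h : C.label u with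
    | var i => rw [eval_var y h]; exact hy i
    | const a => rw [eval_const y h]; exact hC.1 u a h
    | sum =>
      rw [eval_sum y h]
      exact Finset.sum_nonneg fun c hc => mul_nonneg (hC.2 u h c hc) (ih c hc)
    | prod =>
      rw [eval_prod y h]
      exact Finset.prod_nonneg fun c hc => ih c hc

end Basic

/-! ### Formal derivatives of one node with respect to another -/

section Quotient

variable {ι : Type} (C : ArithmeticCircuit ι)

open Classical in
/-- The formal derivative of the node `u` with respect to the node `v`, for circuits in which `v`
occurs at most once in every parse tree. -/
noncomputable def quotient (y : ι → ℝ) (v : C.V) : C.V → ℝ :=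
  C.wellFounded_edge.fix fun u rec =>
    if ¬ C.Below v u then 0
    else if u = v then 1
    else match C.label u with
      | NodeLabel.var _ => 0
      | NodeLabel.const _ => 0
      | NodeLabel.sum => ∑ c ∈ (C.children u).attach, C.weight c.1 u * rec c.1 c.2
      | NodeLabel.prod =>
          ∏ c ∈ (C.children u).attach, if C.Below v c.1 then rec c.1 c.2 else C.eval y c.1

variable {C}

theorem quotient_of_not_below (y : ι → ℝ) {v u : C.V} (h : ¬ C.Below v u) :
    C.quotient y v u = 0 := by
  rw [quotient, WellFounded.fix_eq, if_pos h]

theorem quotient_self (y : ι → ℝ) (u : C.V) : C.quotient y u u = 1 := by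
  rw [quotient, WellFounded.fix_eq, if_neg (not_not.2 (Below.refl u)), if_pos rfl]

theorem quotient_sum (y : ι → ℝ) {v u : C.V} (hu : C.label u = .sum) (hne : u ≠ v) :
    C.quotient y v u = ∑ c ∈ C.children u, C.weight c u * C.quotient y v c := by
  by_cases h : C.Below v u
  · rw [quotient, WellFounded.fix_eq, if_neg (not_not.2 h), if_neg hne, hu]
    exact Finset.sum_attach (C.children u) (fun c => C.weight c u * C.quotient y v c)
  · rw [quotient_of_not_below y h, Finset.sum_eq_zero]
    intro c hc
    rw [quotient_of_not_below y fun h' => h (h'.trans (.of_mem hc)), mul_zero]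

open Classical in
theorem quotient_prod (y : ι → ℝ) {v u : C.V} (hu : C.label u = .prod) (hne : u ≠ v)
    (h : C.Below v u) :
    C.quotient y v u =
      ∏ c ∈ C.children u, if C.Below v c then C.quotient y v c else C.eval y c := by
  rw [quotient, WellFounded.fix_eq, if_neg (not_not.2 h), if_neg hne, hu]
  exact Finset.prod_attach (C.children u)
    (fun c => if C.Below v c then C.quotient y v c else C.eval y c)

open Classical in
-- The Leibniz rule with a single surviving term. It is not required that `v` lies below `c₀`:
-- otherwise `v` lies below no child and both sides vanish, which spares case distinctions in the
-- frontier expansions.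
theorem quotient_prod_eq_mul (y : ι → ℝ) {v u c₀ : C.V} (hu : C.label u = .prod) (hne : u ≠ v)
    (hc₀ : c₀ ∈ C.children u) (h : ∀ c ∈ C.children u, c ≠ c₀ → ¬ C.Below v c) :
    C.quotient y v u = C.quotient y v c₀ * ∏ c ∈ (C.children u).erase c₀, C.eval y c := by
  by_cases h₀ : C.Below v c₀
  · rw [quotient_prod y hu hne (h₀.trans (.of_mem hc₀)), ← Finset.mul_prod_erase _ _ hc₀,
      if_pos h₀]
    congr 1
    refine Finset.prod_congr rfl fun c hc => ?_
    rw [Finset.mem_erase] at hc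
    rw [if_neg (h c hc.2 hc.1)]
  · rw [quotient_of_not_below y h₀, zero_mul, quotient_of_not_below]
    intro hv
    rcases hv.eq_or_exists with rfl | ⟨c, hc, hvc⟩
    · exact hne rfl
    · by_cases hcc : c = c₀
      · exact h₀ (hcc ▸ hvc)
      · exact h c hc hcc hvc

theorem quotient_nonneg (hC : C.IsMonotone) {y : ι → ℝ} (hy : ∀ i, 0 ≤ y i) (v u : C.V) :
    0 ≤ C.quotient y v u := by
  classical
  induction u using C.wellFounded_edge.induction with
  | _ u ih =>
    by_cases hv : C.Below v u
    · by_cases hne : u = v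
      · rw [hne, quotient_self]
        exact zero_le_one
      · obtain ⟨c, hc, -⟩ := hv.eq_or_exists.resolve_left hne
        cases h : C.label u with
        | var i => simp [children_eq_empty_of_var h] at hc
        | const a => simp [children_eq_empty_of_const h] at hc
        | sum =>
          rw [quotient_sum y h hne]
          exact Finset.sum_nonneg fun c hc => mul_nonneg (hC.2 u h c hc) (ih c hc)
        | prod =>
          rw [quotient_prod y h hne hv]
          refine Finset.prod_nonneg fun c hc => ?_
          split_ifs
          · exact ih c hc
          · exact eval_nonneg hC hy c
    · rw [quotient_of_not_below y hv]

end Quotient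

/-! ### Scopes in decomposable and complete circuits -/

/-- `D` satisfies the recursion of the dependency-scopes of a decomposable and complete circuit,
where the variable `i` depends on `p i`. -/
structure IsScopeFunction {ι κ : Type} [DecidableEq κ] (C : ArithmeticCircuit ι) (p : ι → κ)
    (D : C.V → Finset κ) : Prop where
  var : ∀ u i, C.label u = .var i → D u = {p i}
  const : ∀ u a, C.label u = .const a → D u = ∅
  sum : ∀ u, C.label u = .sum → ∀ c ∈ C.children u, D c = D u
  prod : ∀ u, C.label u = .prod → D u = (C.children u).biUnion D
  disjoint : ∀ u, C.label u = .prod → ∀ a ∈ C.children u, ∀ b ∈ C.children u, a ≠ b →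
    Disjoint (D a) (D b)

namespace IsScopeFunction

variable {ι κ : Type} [DecidableEq κ] {C : ArithmeticCircuit ι} {p : ι → κ} {D : C.V → Finset κ}

theorem subset_of_mem (hD : C.IsScopeFunction p D) {c u : C.V} (h : c ∈ C.children u) :
    D c ⊆ D u := by
  cases hu : C.label u with
  | var i => simp [children_eq_empty_of_var hu] at h
  | const a => simp [children_eq_empty_of_const hu] at h
  | sum => exact (hD.sum u hu c h).subset
  | prod =>
    rw [hD.prod u hu]
    exact Finset.subset_biUnion_of_mem D h

theorem subset_of_below (hD : C.IsScopeFunction p D) {v u : C.V} (h : C.Below v u) :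
    D v ⊆ D u := by
  induction h with
  | refl => exact subset_rfl
  | tail _ h ih => exact ih.trans (hD.subset_of_mem h)

theorem card_le_of_below (hD : C.IsScopeFunction p D) {v u : C.V} (h : C.Below v u) :
    (D v).card ≤ (D u).card :=
  Finset.card_le_card (hD.subset_of_below h)

theorem card_add_card_le (hD : C.IsScopeFunction p D) {u a b : C.V} (hu : C.label u = .prod)
    (ha : a ∈ C.children u) (hb : b ∈ C.children u) (hab : a ≠ b) :
    (D a).card + (D b).card ≤ (D u).card := by
  rw [← Finset.card_union_of_disjoint (hD.disjoint u hu a ha b hb hab)]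
  exact Finset.card_le_card (Finset.union_subset (hD.subset_of_mem ha) (hD.subset_of_mem hb))

/-- A node with non-empty scope lies below at most one child of a product node. -/
theorem eq_of_below (hD : C.IsScopeFunction p D) {u a b v : C.V} (hu : C.label u = .prod)
    (ha : a ∈ C.children u) (hb : b ∈ C.children u) (hv : (D v).Nonempty) (hva : C.Below v a)
    (hvb : C.Below v b) : a = b := by
  by_contra hab
  obtain ⟨x, hx⟩ := hv
  exact Finset.disjoint_left.1 (hD.disjoint u hu a ha b hb hab) (hD.subset_of_below hva hx)
    (hD.subset_of_below hvb hx)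

theorem eval_eq_of_empty (hD : C.IsScopeFunction p D) (y y' : ι → ℝ) {u : C.V} (h : D u = ∅) :
    C.eval y u = C.eval y' u := by
  induction u using C.wellFounded_edge.induction with
  | _ u ih =>
    have hc : ∀ c ∈ C.children u, C.eval y c = C.eval y' c := fun c hc =>
      ih c hc (Finset.subset_empty.1 (h ▸ hD.subset_of_mem hc))
    cases hu : C.label u with
    | var i => simp [hD.var u i hu] at h
    | const a => rw [eval_const y hu, eval_const y' hu]
    | sum =>
      rw [eval_sum y hu, eval_sum y' hu]
      exact Finset.sum_congr rfl fun c h' => by rw [hc c h']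
    | prod =>
      rw [eval_prod y hu, eval_prod y' hu]
      exact Finset.prod_congr rfl hc

/-- The scope cannot shrink between `u` and `v`, so every factor split off on the way has empty
scope and is constant. Such quotients become constant leaves of the balanced circuit. -/
theorem quotient_eq_of_eq (hD : C.IsScopeFunction p D) (y y' : ι → ℝ) {v u : C.V}
    (h : D u = D v) : C.quotient y v u = C.quotient y' v u := by
  classical
  induction u using C.wellFounded_edge.induction with
  | _ u ih =>
    by_cases hvu : C.Below v u
    · by_cases hne : u = v
      · rw [hne, quotient_self, quotient_self]
      · have hc : ∀ c ∈ C.children u, C.Below v c → D c = D v := fun c hc hvc =>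
          (h ▸ hD.subset_of_mem hc).antisymm (hD.subset_of_below hvc)
        obtain ⟨c₀, hc₀, hvc₀⟩ := hvu.eq_or_exists.resolve_left hne
        cases hu : C.label u with
        | var i => simp [children_eq_empty_of_var hu] at hc₀
        | const a => simp [children_eq_empty_of_const hu] at hc₀
        | sum =>
          rw [quotient_sum y hu hne, quotient_sum y' hu hne]
          refine Finset.sum_congr rfl fun c h' => ?_
          rw [ih c h' ((hD.sum u hu c h').trans h)]
        | prod =>
          rw [quotient_prod y hu hne hvu, quotient_prod y' hu hne hvu]
          refine Finset.prod_congr rfl fun c h' => ?_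
          split_ifs with hvc
          · exact ih c h' (hc c h' hvc)
          · refine hD.eval_eq_of_empty y y' ?_
            -- The child `c₀` above `v` already carries the whole scope of `u`, so a disjoint
            -- sibling has none left.
            have hd := hD.disjoint u hu c h' c₀ hc₀ (fun he => hvc (he ▸ hvc₀))
            rw [hc c₀ hc₀ hvc₀, ← h] at hd
            exact (Finset.disjoint_self_iff_empty _).1
              (hd.mono_right (hD.subset_of_mem h'))
    · rw [quotient_of_not_below y hvu, quotient_of_not_below y' hvu]

end IsScopeFunction

/-! ### Frontier expansions of values and quotients -/

/-- `t` is minimal among the nodes whose scope has more than `k / 2` elements. -/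
def IsFrontier {ι κ : Type} (C : ArithmeticCircuit ι) (D : C.V → Finset κ) (k : ℕ) (t : C.V) :
    Prop :=
  C.label t ≠ .sum ∧ k < 2 * (D t).card ∧ ∀ c ∈ C.children t, 2 * (D c).card ≤ k

/-- `t` is minimal among the nodes above `v` whose scope has more than `k / 2` elements. -/
def IsFrontierAbove {ι κ : Type} (C : ArithmeticCircuit ι) (D : C.V → Finset κ) (v : C.V) (k : ℕ)
    (t : C.V) : Prop :=
  C.label t = .prod ∧ C.Below v t ∧ k < 2 * (D t).card ∧
    ∀ c ∈ C.children t, C.Below v c → 2 * (D c).card ≤ k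

namespace IsScopeFunction

variable {ι κ : Type} [DecidableEq κ] {C : ArithmeticCircuit ι} {p : ι → κ} {D : C.V → Finset κ}

theorem exists_isFrontier (hD : C.IsScopeFunction p D) {k : ℕ} {u : C.V}
    (hu : k < 2 * (D u).card) : ∃ t, C.Below t u ∧ C.IsFrontier D k t := by
  obtain ⟨t, ⟨ht, htk⟩, hmin⟩ := C.wellFounded_edge.has_min
    {t | C.Below t u ∧ k < 2 * (D t).card} ⟨u, .refl u, hu⟩
  have hc : ∀ c ∈ C.children t, 2 * (D c).card ≤ k := fun c hc => by
    by_contra h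
    exact hmin c ⟨(Below.of_mem hc).trans ht, not_le.1 h⟩ hc
  refine ⟨t, ht, fun hs => ?_, htk, hc⟩
  obtain ⟨c, hct⟩ := children_nonempty_of_sum hs
  have := hc c hct
  rw [hD.sum t hs c hct] at this
  omega

theorem exists_isFrontierAbove (hD : C.IsScopeFunction p D) {k : ℕ} {v u : C.V}
    (hvu : C.Below v u) (hv : 2 * (D v).card ≤ k) (hu : k < 2 * (D u).card) :
    ∃ t, C.Below t u ∧ C.IsFrontierAbove D v k t := by
  obtain ⟨t, ⟨ht, hvt, htk⟩, hmin⟩ := C.wellFounded_edge.has_min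
    {t | C.Below t u ∧ C.Below v t ∧ k < 2 * (D t).card} ⟨u, .refl u, hvu, hu⟩
  have hc : ∀ c ∈ C.children t, C.Below v c → 2 * (D c).card ≤ k := fun c hc hvc => by
    by_contra h
    exact hmin c ⟨(Below.of_mem hc).trans ht, hvc, not_le.1 h⟩ hc
  refine ⟨t, ht, ?_, hvt, htk, hc⟩
  obtain ⟨c, hct, hvc⟩ := hvt.eq_or_exists.resolve_left (by rintro rfl; omega)
  have hck := hc c hct hvc
  cases hl : C.label t with
  | var i => simp [children_eq_empty_of_var hl] at hct
  | const a => simp [children_eq_empty_of_const hl] at hct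
  | sum =>
    rw [hD.sum t hl c hct] at hck
    omega
  | prod => rfl

open Classical in
-- Every parse tree of `w` meets the frontier exactly once: two disjoint branches cannot both exceed
-- half of `k`. The threshold `k` is independent of `w` so that it stays fixed during the induction.
theorem eval_eq_sum_frontier (hD : C.IsScopeFunction p D) (y : ι → ℝ) {k : ℕ} {w : C.V}
    (hk : (D w).card ≤ k) (hw : k < 2 * (D w).card) :
    C.eval y w = ∑ t with C.IsFrontier D k t, C.quotient y t w * C.eval y t := by
  induction w using C.wellFounded_edge.induction with
  | _ w ih =>
    by_cases hwF : C.IsFrontier D k w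
    · rw [Finset.sum_eq_single w, quotient_self, one_mul]
      · intro t ht htw
        rw [quotient_of_not_below, zero_mul]
        intro hb
        obtain ⟨c, hc, htc⟩ := hb.eq_or_exists.resolve_left htw.symm
        have := hD.card_le_of_below htc
        have := hwF.2.2 c hc
        have := (Finset.mem_filter.1 ht).2.2.1
        omega
      · intro h
        exact absurd (Finset.mem_filter.2 ⟨Finset.mem_univ _, hwF⟩) h
    · have hne : ∀ t, C.IsFrontier D k t → w ≠ t := by
        rintro t ht rfl
        exact hwF ht
      cases hl : C.label w with
      | var i =>
        -- A variable above the threshold has no children and is itself on the frontier.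
        refine absurd ⟨by simp [hl], hw, ?_⟩ hwF
        simp [children_eq_empty_of_var hl]
      | const a =>
        rw [hD.const w a hl] at hw
        simp at hw
      | sum =>
        have h1 : ∀ c ∈ C.children w, C.weight c w * C.eval y c =
            ∑ t with C.IsFrontier D k t, C.weight c w * (C.quotient y t c * C.eval y t) := by
          intro c hc
          have hcw := hD.sum w hl c hc
          rw [ih c hc (hcw ▸ hk) (hcw ▸ hw), Finset.mul_sum]
        rw [eval_sum y hl, Finset.sum_congr rfl h1, Finset.sum_comm]
        refine Finset.sum_congr rfl fun t ht => ?_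
        rw [quotient_sum y hl (hne t (Finset.mem_filter.1 ht).2), Finset.sum_mul]
        exact Finset.sum_congr rfl fun c _ => by ring
      | prod =>
        -- A product off the frontier has a child still above the threshold. Since `(D w).card ≤ k`,
        -- no sibling of it is large enough to contain a frontier node.
        obtain ⟨c₀, hc₀, hk₀⟩ : ∃ c ∈ C.children w, k < 2 * (D c).card := by
          by_contra! h
          exact hwF ⟨by simp [hl], hw, h⟩
        rw [eval_prod y hl, ← Finset.mul_prod_erase _ _ hc₀,
          ih c₀ hc₀ ((hD.card_le_of_below (.of_mem hc₀)).trans hk) hk₀, Finset.sum_mul]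
        refine Finset.sum_congr rfl fun t ht => ?_
        have ht' := (Finset.mem_filter.1 ht).2
        rw [quotient_prod_eq_mul y hl (hne t ht') hc₀]
        · ring
        · intro c hc hcc htc
          have := hD.card_le_of_below htc
          have := hD.card_add_card_le hl hc hc₀ hcc
          have := ht'.2.1
          omega

open Classical in
-- The chain rule along the path from `w` down to `v`. The scopes on it decrease, so it crosses the
-- threshold once. Non-emptiness of `D v` makes the branch at each product unique, so `(D w).card ≤
-- k` is not needed here.
theorem quotient_eq_sum_frontier (hD : C.IsScopeFunction p D) (y : ι → ℝ) {k : ℕ} {v w : C.V}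
    (hv : (D v).Nonempty) (hvk : 2 * (D v).card ≤ k) (hvw : C.Below v w)
    (hw : k < 2 * (D w).card) :
    C.quotient y v w =
      ∑ t with C.IsFrontierAbove D v k t, C.quotient y t w * C.quotient y v t := by
  induction w using C.wellFounded_edge.induction with
  | _ w ih =>
    by_cases hwF : C.IsFrontierAbove D v k w
    · rw [Finset.sum_eq_single w, quotient_self, one_mul]
      · intro t ht htw
        have ht' := (Finset.mem_filter.1 ht).2
        rw [quotient_of_not_below, zero_mul]
        intro hb
        obtain ⟨c, hc, htc⟩ := hb.eq_or_exists.resolve_left htw.symm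
        have := hD.card_le_of_below htc
        have := hwF.2.2.2 c hc (ht'.2.1.trans htc)
        have := ht'.2.2.1
        omega
      · intro h
        exact absurd (Finset.mem_filter.2 ⟨Finset.mem_univ _, hwF⟩) h
    · have hne : ∀ t, C.IsFrontierAbove D v k t → w ≠ t := by
        rintro t ht rfl
        exact hwF ht
      have hwv : w ≠ v := by
        rintro rfl
        omega
      obtain ⟨c₁, hc₁, -⟩ := hvw.eq_or_exists.resolve_left hwv
      cases hl : C.label w with
      | var i => simp [children_eq_empty_of_var hl] at hc₁
      | const a => simp [children_eq_empty_of_const hl] at hc₁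
      | sum =>
        have h1 : ∀ c ∈ C.children w, C.weight c w * C.quotient y v c =
            ∑ t with C.IsFrontierAbove D v k t,
              C.weight c w * (C.quotient y t c * C.quotient y v t) := by
          intro c hc
          rw [← Finset.mul_sum]
          by_cases hvc : C.Below v c
          · rw [ih c hc hvc ((hD.sum w hl c hc).symm ▸ hw)]
          -- A child that is not above `v` is not above any `t` that is above `v`, so both sides are
          -- zero.
          · rw [quotient_of_not_below y hvc, Finset.sum_eq_zero]
            intro t ht
            rw [quotient_of_not_below, zero_mul]
            exact fun htc => hvc ((Finset.mem_filter.1 ht).2.2.1.trans htc)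
        rw [quotient_sum y hl hwv, Finset.sum_congr rfl h1, Finset.sum_comm]
        refine Finset.sum_congr rfl fun t ht => ?_
        rw [quotient_sum y hl (hne t (Finset.mem_filter.1 ht).2), Finset.sum_mul]
        exact Finset.sum_congr rfl fun c _ => by ring
      | prod =>
        obtain ⟨c₀, hc₀, hvc₀, hk₀⟩ :
            ∃ c ∈ C.children w, C.Below v c ∧ k < 2 * (D c).card := by
          by_contra! h
          exact hwF ⟨hl, hvw, hw, h⟩
        have huniq : ∀ c ∈ C.children w, c ≠ c₀ → ¬ C.Below v c := fun c hc hcc hvc =>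
          hcc (hD.eq_of_below hl hc hc₀ hv hvc hvc₀)
        rw [quotient_prod_eq_mul y hl hwv hc₀ huniq, ih c₀ hc₀ hvc₀ hk₀, Finset.sum_mul]
        refine Finset.sum_congr rfl fun t ht => ?_
        have ht' := (Finset.mem_filter.1 ht).2
        rw [quotient_prod_eq_mul y hl (hne t ht') hc₀ fun c hc hcc htc =>
          huniq c hc hcc (ht'.2.1.trans htc)]
        ring

end IsScopeFunction

end ArithmeticCircuit

/-! ### Assembling an SPN from locally valid nodes -/

/-- The conditions on a node of a circuit with unit weights, with values `val` and scopes `D`, for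
the circuit to be monotone, decomposable and complete. -/
def IsValidNode {n : ℕ} {F : UnivariateData n} {N : Type} (label : N → NodeLabel F.Idx)
    (children : N → Finset N) (D : N → Finset (Fin n)) (val : (F.Idx → ℝ) → N → ℝ) (u : N) :
    Prop :=
  (∃ i, label u = .var i ∧ children u = ∅ ∧ D u = {i.1} ∧ ∀ y, val y u = y i) ∨
  (∃ a, label u = .const a ∧ children u = ∅ ∧ D u = ∅ ∧ 0 ≤ a ∧ ∀ y, val y u = a) ∨
  (label u = .sum ∧ (children u).Nonempty ∧ (∀ c ∈ children u, D c = D u) ∧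
    ∀ y, val y u = ∑ c ∈ children u, val y c) ∨
  (label u = .prod ∧ (children u).Nonempty ∧ D u = (children u).biUnion D ∧
    (∀ a ∈ children u, ∀ b ∈ children u, a ≠ b → Disjoint (D a) (D b)) ∧
    ∀ y, val y u = ∏ c ∈ children u, val y c)

namespace ArithmeticCircuit

variable {ι : Type} {C : ArithmeticCircuit ι}

theorem depth_le_of_rank (rank : C.V → ℕ) {d : ℕ} (h : ∀ a b, C.Edge a b → rank a < rank b)
    (hd : ∀ a, rank a ≤ d) : C.depth ≤ d := by
  obtain ⟨p, hp, hlen⟩ := C.isGreatest_depth.1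
  have key : ∀ (l : List C.V) (a : C.V), (a :: l).IsChain C.Edge → rank a + l.length ≤ d := by
    intro l
    induction l with
    | nil => intro a _; simpa using hd a
    | cons b l ih =>
      intro a hab
      rw [List.isChain_cons_cons] at hab
      have := ih b hab.2
      have := h a b hab.1
      simp only [List.length_cons]
      omega
  cases p with
  | nil => simp at hlen
  | cons a l =>
    have := key l a hp
    simp only [List.length_cons] at hlen
    omega

theorem IsScopeFunction.image_scope {κ : Type} [DecidableEq κ] {p : ι → κ} {D : C.V → Finset κ}
    (hD : C.IsScopeFunction p D) (u : C.V) : p '' C.scope u = D u := by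
  ext x
  constructor
  · rintro ⟨i, ⟨v, hvu, hv⟩, rfl⟩
    refine hD.subset_of_below hvu ?_
    simp [hD.var v i hv]
  · intro hx
    induction u using C.wellFounded_edge.induction with
    | _ u ih =>
      have key : ∀ c ∈ C.children u, x ∈ D c → x ∈ p '' C.scope u := by
        intro c hc hxc
        obtain ⟨i, ⟨v, hvc, hv⟩, rfl⟩ := ih c hc hxc
        exact ⟨i, ⟨v, hvc.tail hc, hv⟩, rfl⟩
      cases hu : C.label u with
      | var i =>
        rw [hD.var u i hu] at hx
        exact ⟨i, ⟨u, .refl, hu⟩, (Finset.mem_singleton.1 hx).symm⟩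
      | const a => simp [hD.const u a hu] at hx
      | sum =>
        obtain ⟨c, hc⟩ := children_nonempty_of_sum hu
        exact key c hc ((hD.sum u hu c hc).symm ▸ hx)
      | prod =>
        rw [hD.prod u hu, Finset.mem_coe, Finset.mem_biUnion] at hx
        obtain ⟨c, hc, hxc⟩ := hx
        exact key c hc hxc

theorem scope_eq_biUnion_children {u : C.V} (hu : ∀ i, C.label u ≠ .var i) :
    C.scope u = ⋃ c ∈ C.children u, C.scope c := by
  ext i
  simp only [Set.mem_iUnion]
  constructor
  · rintro ⟨v, hvu, hv⟩
    rcases Relation.ReflTransGen.cases_tail hvu with rfl | ⟨c, hvc, hc⟩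
    · exact absurd hv (hu i)
    · exact ⟨c, hc, v, hvc, hv⟩
  · rintro ⟨c, hc, v, hvc, hv⟩
    exact ⟨v, hvc.tail hc, hv⟩

end ArithmeticCircuit

namespace SPN

open ArithmeticCircuit

variable {n : ℕ} {F : UnivariateData n}

theorem dependencyScope_eq_biUnion (Φ : SPN F) {u : Φ.V} (hu : ∀ i, Φ.label u ≠ .var i) :
    Φ.dependencyScope u = ⋃ c ∈ Φ.children u, Φ.dependencyScope c := by
  simp only [dependencyScope, scope_eq_biUnion_children hu, Set.image_iUnion]

open Classical in
theorem IsDC.isScopeFunction {Φ : SPN F} (h : Φ.IsDC) :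
    Φ.IsScopeFunction Sigma.fst fun u => {x | x ∈ Φ.dependencyScope u} where
  var u i hu := by
    ext x
    rw [Finset.mem_filter_univ, Finset.mem_singleton]
    constructor
    · rintro ⟨j, ⟨v, hvu, hv⟩, rfl⟩
      rcases Relation.ReflTransGen.cases_tail hvu with rfl | ⟨c, -, hc⟩
      · rw [hu] at hv
        rw [NodeLabel.var.inj hv]
      · have : c ∈ Φ.children u := hc
        simp [children_eq_empty_of_var hu] at this
    · rintro rfl
      exact ⟨i, ⟨u, .refl, hu⟩, rfl⟩
  const u a hu := by
    ext x
    rw [Finset.mem_filter_univ, dependencyScope_eq_biUnion Φ (by simp [hu]),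
      children_eq_empty_of_const hu]
    simp
  sum u hu c hc := by
    suffices h' : Φ.dependencyScope c = Φ.dependencyScope u by rw [h']
    rw [dependencyScope_eq_biUnion Φ (u := u) (by simp [hu])]
    refine (Set.subset_biUnion_of_mem (u := Φ.dependencyScope) hc).antisymm ?_
    exact Set.iUnion₂_subset fun d hd => (h.2 u hu d hd c hc).subset
  prod u hu := by
    ext x
    rw [Finset.mem_filter_univ, dependencyScope_eq_biUnion Φ (u := u) (by simp [hu])]
    simp
  disjoint u hu a ha b hb hab := by
    refine Finset.disjoint_left.2 fun x hxa hxb => ?_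
    rw [Finset.mem_filter_univ] at hxa hxb
    exact Set.disjoint_left.1 (h.1 u hu a ha b hb hab) hxa hxb

theorem isDC_of_isScopeFunction {Φ : SPN F} {D : Φ.V → Finset (Fin n)}
    (hD : Φ.IsScopeFunction Sigma.fst D) : Φ.IsDC := by
  have h : ∀ u, Φ.dependencyScope u = D u := hD.image_scope
  refine ⟨fun u hu a ha b hb hab => ?_, fun u hu a ha b hb => ?_⟩
  · rw [h, h, Finset.disjoint_coe]
    exact hD.disjoint u hu a ha b hb hab
  · rw [h, h, hD.sum u hu a ha, hD.sum u hu b hb]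

/-- The circuit formed by the nodes from which `r` can be reached. -/
theorem exists_of_isValidNode {N : Type} [Finite N] (label : N → NodeLabel F.Idx)
    (children : N → Finset N) (D : N → Finset (Fin n)) (val : (F.Idx → ℝ) → N → ℝ)
    (rank : N → ℕ) (P : N → Prop) (r : N) (hr : P r)
    (hP : ∀ b, P b → ∀ a ∈ children b, P a ∧ rank a < rank b)
    (hvalid : ∀ u, P u → IsValidNode label children D val u) :
    ∃ Φ : SPN F, Φ.IsDC ∧ (∀ y, Φ.output y = val y r) ∧ Φ.size ≤ Nat.card N ∧
      Φ.depth ≤ rank r := by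
  classical
  -- Only nodes that reach `r` are kept: this makes `r` the unique sink, and `P` descends from `r`
  -- to all of them, so validity elsewhere is irrelevant.
  let Q : N → Prop := fun a => Relation.ReflTransGen (fun a b => a ∈ children b) a r
  have hQP : ∀ a, Q a → P a ∧ rank a ≤ rank r := by
    intro a ha
    induction ha using Relation.ReflTransGen.head_induction_on with
    | refl => exact ⟨hr, le_rfl⟩
    | head h _ ih =>
      have := hP _ ih.1 _ h
      exact ⟨this.1, this.2.le.trans ih.2⟩
  have hQc : ∀ u, Q u → ∀ c ∈ children u, Q c := fun u hu c hc => hu.head hc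
  have hmem : ∀ a b : {a // Q a}, a ∈ (children b.1).subtype Q ↔ a.1 ∈ children b.1 := by
    simp
  have hrank : ∀ a b : {a // Q a}, a ∈ (children b.1).subtype Q → rank a.1 < rank b.1 :=
    fun a b h => (hP _ (hQP _ b.2).1 _ ((hmem a b).1 h)).2
  have hempty : ∀ u : {a // Q a}, (children u.1).subtype Q = ∅ ↔ children u.1 = ∅ := by
    intro u
    rw [Finset.subtype_eq_empty, Finset.eq_empty_iff_forall_notMem]
    exact ⟨fun h c hc => h c (hQc _ u.2 c hc) hc, fun h c _ => h c⟩
  let C : ArithmeticCircuit F.Idx :=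
    { V := {a // Q a}
      fintypeV := Fintype.ofFinite _
      label := fun u => label u.1
      children := fun u => (children u.1).subtype Q
      weight := fun _ _ => 1
      root := ⟨r, .refl⟩
      acyclic := by
        intro v hv
        have key : ∀ a b : {a // Q a},
            Relation.TransGen (fun a b => a ∈ (children b.1).subtype Q) a b →
              rank a.1 < rank b.1 := by
          intro a b h
          induction h with
          | single h => exact hrank _ _ h
          | tail _ h ih => exact ih.trans (hrank _ _ h)
        exact lt_irrefl _ (key v v hv)
      leaf_iff := by
        intro v
        rw [hempty]
        rcases hvalid v.1 (hQP _ v.2).1 with ⟨i, h, h', -⟩ | ⟨a, h, h', -⟩ | ⟨h, h', -⟩ | ⟨h, h', -⟩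
        · simp [h, h']
        · simp [h, h']
        · simp [h, h'.ne_empty]
        · simp [h, h'.ne_empty]
      root_iff := by
        intro v
        constructor
        · intro h
          rcases Relation.ReflTransGen.cases_head v.2 with h' | ⟨c, hc, hcr⟩
          · exact Subtype.ext h'
          · exact absurd ((hmem v ⟨c, hcr⟩).2 hc) (h ⟨c, hcr⟩)
        -- An edge out of `r` would lead to a rank above the maximum, which is attained at `r`.
        · rintro rfl u hu
          exact absurd (hrank _ _ hu) (not_lt.2 (hQP _ u.2).2) }
  have hvar : ∀ u : C.V, IsValidNode label children D val u.1 := fun u =>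
    hvalid u.1 (hQP _ u.2).1
  have hscope : C.IsScopeFunction Sigma.fst fun u => D u.1 := by
    constructor
    · intro u i (hu : label u.1 = _)
      rcases hvar u with ⟨j, h, -, h', -⟩ | ⟨a, h, -⟩ | ⟨h, -⟩ | ⟨h, -⟩ <;> rw [hu] at h
      · rw [h', NodeLabel.var.inj h]
      all_goals cases h
    · intro u b (hu : label u.1 = _)
      rcases hvar u with ⟨j, h, -⟩ | ⟨a, h, -, h', -⟩ | ⟨h, -⟩ | ⟨h, -⟩ <;> rw [hu] at h
      · cases h
      · exact h'
      all_goals cases h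
    · intro u (hu : label u.1 = _) c hc
      rcases hvar u with ⟨j, h, -⟩ | ⟨a, h, -⟩ | ⟨h, -, h', -⟩ | ⟨h, -⟩ <;> rw [hu] at h
      · cases h
      · cases h
      · exact h' _ ((hmem c u).1 hc)
      · cases h
    · intro u (hu : label u.1 = _)
      rcases hvar u with ⟨j, h, -⟩ | ⟨a, h, -⟩ | ⟨h, -⟩ | ⟨h, -, h', -⟩ <;> rw [hu] at h
      · cases h
      · cases h
      · cases h
      · rw [h']
        ext x
        simp only [Finset.mem_biUnion]
        constructor
        · rintro ⟨c, hc, hx⟩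
          exact ⟨⟨c, hQc _ u.2 c hc⟩, (hmem _ u).2 hc, hx⟩
        · rintro ⟨c, hc, hx⟩
          exact ⟨c.1, (hmem _ u).1 hc, hx⟩
    · intro u (hu : label u.1 = _) a ha b hb hab
      rcases hvar u with ⟨j, h, -⟩ | ⟨a, h, -⟩ | ⟨h, -⟩ | ⟨h, -, -, h', -⟩ <;> rw [hu] at h
      · cases h
      · cases h
      · cases h
      · exact h' _ ((hmem a u).1 ha) _ ((hmem b u).1 hb) fun h => hab (Subtype.ext h)
  have heval : ∀ y (u : C.V), C.eval y u = val y u.1 := by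
    intro y u
    induction u using C.wellFounded_edge.induction with
    | _ u ih =>
      rcases hvar u with ⟨j, h, -, -, h'⟩ | ⟨a, h, -, -, -, h'⟩ | ⟨h, -, -, h'⟩ | ⟨h, -, -, -, h'⟩
      · rw [eval_var y (C := C) h, h']
      · rw [eval_const y (C := C) h, h']
      · rw [eval_sum y (C := C) h, h', ← Finset.sum_subtype_of_mem _ (hQc _ u.2)]
        refine Finset.sum_congr rfl fun c hc => ?_
        rw [ih c hc]
        exact one_mul _
      · rw [eval_prod y (C := C) h, h', ← Finset.prod_subtype_of_mem _ (hQc _ u.2)]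
        exact Finset.prod_congr rfl fun c hc => ih c hc
  have hmono : C.IsMonotone := by
    refine ⟨fun u b (hu : label u.1 = _) => ?_, fun _ _ _ _ => zero_le_one⟩
    rcases hvar u with ⟨j, h, -⟩ | ⟨a, h, -, -, h', -⟩ | ⟨h, -⟩ | ⟨h, -⟩ <;> rw [hu] at h
    · cases h
    · rw [NodeLabel.const.inj h]
      exact h'
    all_goals cases h
  refine ⟨⟨C, hmono⟩, isDC_of_isScopeFunction hscope, fun y => heval y C.root, ?_, ?_⟩
  · refine (@Nat.card_eq_fintype_card C.V C.fintypeV).symm.trans_le ?_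
    exact Nat.card_le_card_of_injective (fun u : {a // Q a} => u.1) Subtype.val_injective
  · exact depth_le_of_rank (C := C) (fun u => rank u.1) hrank fun u => (hQP _ u.2).2

end SPN

/-! ### The balanced circuit -/

/-- The nodes of the balanced circuit: the nodes `u` of the original circuit, its leaves, the
quotients `u / v`, and the terms of the sums for `u` and `u / v` that belong to the frontier node
`t`. -/
inductive BalancedNode (V : Type) where
  | node (u : V)
  | leaf (u : V)
  | quot (u v : V)
  | nodeProd (u t : V)
  | quotProd (u v t : V)

namespace BalancedNode

/-- A surjection that bounds the number of nodes of the balanced circuit. -/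
def ofTuple {V : Type} : Fin 5 × V × V × V → BalancedNode V
  | (0, u, _, _) => node u
  | (1, u, _, _) => leaf u
  | (2, u, v, _) => quot u v
  | (3, u, v, _) => nodeProd u v
  | (4, u, v, t) => quotProd u v t

theorem ofTuple_surjective {V : Type} : Function.Surjective (ofTuple (V := V))
  | node u => ⟨(0, u, u, u), rfl⟩
  | leaf u => ⟨(1, u, u, u), rfl⟩
  | quot u v => ⟨(2, u, v, u), rfl⟩
  | nodeProd u t => ⟨(3, u, t, u), rfl⟩
  | quotProd u v t => ⟨(4, u, v, t), rfl⟩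

instance {V : Type} [Finite V] : Finite (BalancedNode V) :=
  Finite.of_surjective _ ofTuple_surjective

theorem card_le {V : Type} [Finite V] : Nat.card (BalancedNode V) ≤ 5 * Nat.card V ^ 3 := by
  refine (Nat.card_le_card_of_surjective _ (ofTuple_surjective (V := V))).trans_eq ?_
  simp only [Nat.card_prod, Nat.card_fin]
  ring

open ArithmeticCircuit

open Classical in
/-- The labels of the balanced circuit. -/
noncomputable def label {ι κ : Type} (C : ArithmeticCircuit ι) (D : C.V → Finset κ) :
    BalancedNode C.V → NodeLabel ι
  | node u => if (D u).card = 0 then .const (C.eval 0 u) else .sum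
  | leaf u => C.label u
  | quot u v => if (D u).card ≤ (D v).card then .const (C.quotient 0 v u) else .sum
  | nodeProd _ _ => .prod
  | quotProd _ _ _ => .prod

open Classical in
/-- The children of the nodes of the balanced circuit. -/
noncomputable def children {ι κ : Type} (C : ArithmeticCircuit ι) (D : C.V → Finset κ) :
    BalancedNode C.V → Finset (BalancedNode C.V)
  | node u => if (D u).card = 0 then ∅ else
      Finset.image (nodeProd u) {t | C.Below t u ∧ C.IsFrontier D (D u).card t}
  | leaf _ => ∅
  | quot u v => if (D u).card ≤ (D v).card then ∅ else
      Finset.image (quotProd u v)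
        {t | C.Below t u ∧ C.IsFrontierAbove D v ((D u).card + (D v).card) t}
  | nodeProd u t => insert (quot u t)
      (if C.label t = .prod then (C.children t).image node else {leaf t})
  | quotProd u v t => insert (quot u t)
      ((C.children t).image fun c => if C.Below v c then quot c v else node c)

/-- The scopes of the nodes of the balanced circuit. -/
def scope {V κ : Type} [DecidableEq κ] (D : V → Finset κ) : BalancedNode V → Finset κ
  | node u => D u
  | leaf u => D u
  | quot u v => D u \ D v
  | nodeProd u _ => D u
  | quotProd u v _ => D u \ D v

/-- The values of the nodes of the balanced circuit. -/
noncomputable def value {ι : Type} (C : ArithmeticCircuit ι) (y : ι → ℝ) :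
    BalancedNode C.V → ℝ
  | node u => C.eval y u
  | leaf u => C.eval y u
  | quot u v => C.quotient y v u
  | nodeProd u t => C.quotient y t u * C.eval y t
  | quotProd u v t => C.quotient y t u * C.quotient y v t

/-- A bound on the length of the paths that end in a node of the balanced circuit. -/
def rank {V κ : Type} (D : V → Finset κ) : BalancedNode V → ℕ
  | node u => 4 * (D u).card.size + 1
  | leaf _ => 0
  | quot u v => 4 * ((D u).card - (D v).card).size + 3
  | nodeProd u _ => 4 * (D u).card.size
  | quotProd u v _ => 4 * ((D u).card - (D v).card).size + 2

/-- The nodes that the balanced circuit may use. -/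
def IsUsed {ι κ : Type} (C : ArithmeticCircuit ι) (D : C.V → Finset κ) : BalancedNode C.V → Prop
  | node _ => True
  | leaf u => ∃ i, C.label u = .var i
  | quot u v => C.Below v u ∧ (D v).Nonempty
  | nodeProd u t => C.Below t u ∧ C.IsFrontier D (D u).card t
  | quotProd u v t => C.Below t u ∧ (D v).Nonempty ∧
      C.IsFrontierAbove D v ((D u).card + (D v).card) t

/-- Halving shortens the binary expansion; `0 < b` excludes `a = b = 0`. -/
theorem size_lt_size_of_two_mul_le {a b : ℕ} (h : 2 * a ≤ b) (hb : 0 < b) : a.size < b.size := by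
  rw [Nat.lt_size]
  rcases Nat.eq_zero_or_pos a with rfl | ha
  · simpa using Nat.succ_le_of_lt hb
  · have h1 : 0 < a.size := Nat.size_pos.2 ha
    have h2 : 2 ^ (a.size - 1) ≤ a := Nat.lt_size.1 (by omega)
    calc 2 ^ a.size = 2 * 2 ^ (a.size - 1) := by rw [← pow_succ']; congr 1; omega
      _ ≤ b := by omega

section

variable {ι κ : Type} [DecidableEq κ] {C : ArithmeticCircuit ι} {p : ι → κ} {D : C.V → Finset κ}

theorem label_eq_of_isFrontier (hD : C.IsScopeFunction p D) {k : ℕ} {t : C.V}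
    (ht : C.IsFrontier D k t) : C.label t = .prod ∨ ∃ i, C.label t = .var i := by
  cases h : C.label t with
  | var i => exact Or.inr ⟨i, rfl⟩
  | const a =>
    have := ht.2.1
    rw [hD.const t a h] at this
    simp at this
  | sum => exact absurd h ht.1
  | prod => exact Or.inl rfl

/-- The halving estimates behind the depth bound. Each bit of the scope size gets four layers,
ordered by the offsets 3, 2, 1, 0 in `rank`; a halving drops a bit and so pays for a return to
offset 3. -/
theorem isUsed_and_rank_lt (hD : C.IsScopeFunction p D) (b : BalancedNode C.V)
    (hb : IsUsed C D b) : ∀ a ∈ children C D b, IsUsed C D a ∧ rank D a < rank D b := by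
  classical
  intro a ha
  cases b with
  | node u =>
    rw [children] at ha
    split_ifs at ha with hu
    · simp at ha
    · obtain ⟨t, ht, rfl⟩ := Finset.mem_image.1 ha
      exact ⟨(Finset.mem_filter.1 ht).2, by simp [rank]⟩
  | leaf u => simp [children] at ha
  | quot u v =>
    rw [children] at ha
    split_ifs at ha with hu
    · simp at ha
    · obtain ⟨t, ht, rfl⟩ := Finset.mem_image.1 ha
      have ht := (Finset.mem_filter.1 ht).2
      exact ⟨⟨ht.1, hb.2, ht.2⟩, by simp [rank]⟩
  | nodeProd u t =>
    obtain ⟨htu, ht⟩ := hb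
    have htc := hD.card_le_of_below htu
    have htk := ht.2.1
    rw [children, Finset.mem_insert] at ha
    rcases ha with rfl | ha
    · refine ⟨⟨htu, Finset.card_pos.1 (by omega)⟩, ?_⟩
      have : ((D u).card - (D t).card).size < (D u).card.size :=
        size_lt_size_of_two_mul_le (by omega) (by omega)
      simp only [rank]
      omega
    · split_ifs at ha with hl
      · obtain ⟨c, hc, rfl⟩ := Finset.mem_image.1 ha
        refine ⟨trivial, ?_⟩
        have : (D c).card.size < (D u).card.size :=
          size_lt_size_of_two_mul_le (ht.2.2 c hc) (by omega)
        simp only [rank]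
        omega
      · rw [Finset.mem_singleton.1 ha]
        refine ⟨(label_eq_of_isFrontier hD ht).resolve_left hl, ?_⟩
        have : 0 < (D u).card.size := Nat.size_pos.2 (by omega)
        simp only [rank]
        omega
  | quotProd u v t =>
    obtain ⟨htu, hv, hl, hvt, htk, hc⟩ := hb
    have htc := hD.card_le_of_below htu
    have hvtc := hD.card_le_of_below hvt
    have hv' := Finset.card_pos.2 hv
    rw [children, Finset.mem_insert] at ha
    rcases ha with rfl | ha
    · refine ⟨⟨htu, Finset.card_pos.1 (by omega)⟩, ?_⟩
      have : ((D u).card - (D t).card).size < ((D u).card - (D v).card).size :=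
        size_lt_size_of_two_mul_le (by omega) (by omega)
      simp only [rank]
      omega
    · obtain ⟨c, hct, rfl⟩ := Finset.mem_image.1 ha
      split_ifs with hvc
      · refine ⟨⟨hvc, hv⟩, ?_⟩
        have := hc c hct hvc
        have : ((D c).card - (D v).card).size < ((D u).card - (D v).card).size :=
          size_lt_size_of_two_mul_le (by omega) (by omega)
        simp only [rank]
        omega
      · refine ⟨trivial, ?_⟩
        obtain ⟨c₀, hc₀, hvc₀⟩ := hvt.eq_or_exists.resolve_left (by rintro rfl; omega)
        have h1 := hD.card_add_card_le hl hct hc₀ (by rintro rfl; exact hvc hvc₀)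
        have h2 := hD.card_le_of_below hvc₀
        -- The siblings of the child above `v` need not be halved: their scopes lie in that of `u /
        -- v`, and the step from offset 2 to offset 1 suffices.
        have : (D c).card.size ≤ ((D u).card - (D v).card).size :=
          Nat.size_le_size (by omega)
        simp only [rank]
        omega

end

variable {n : ℕ} {F : UnivariateData n} {C : ArithmeticCircuit F.Idx} {D : C.V → Finset (Fin n)}

theorem isValidNode_node (hC : C.IsMonotone) (hD : C.IsScopeFunction Sigma.fst D) (u : C.V) :
    IsValidNode (label C D) (children C D) (scope D) (value C) (node u) := by
  classical
  by_cases hu : (D u).card = 0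
  · have h0 := Finset.card_eq_zero.1 hu
    -- The value does not depend on the point; evaluating at `0`, which is non-negative, shows that
    -- the constant is non-negative.
    exact Or.inr <| Or.inl ⟨C.eval 0 u, by rw [label, if_pos hu], by rw [children, if_pos hu], h0,
      eval_nonneg hC (fun _ => le_rfl) u, fun y => hD.eval_eq_of_empty y 0 h0⟩
  · refine Or.inr <| Or.inr <| Or.inl ⟨by rw [label, if_neg hu], ?_, ?_, fun y => ?_⟩ <;>
      rw [children, if_neg hu]
    · obtain ⟨t, ht⟩ := hD.exists_isFrontier (k := (D u).card) (u := u) (by omega)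
      exact ⟨_, Finset.mem_image_of_mem _ (Finset.mem_filter.2 ⟨Finset.mem_univ t, ht⟩)⟩
    · intro c hc
      obtain ⟨t, -, rfl⟩ := Finset.mem_image.1 hc
      rfl
    · rw [Finset.sum_image fun a _ b _ h => by simpa using h]
      simp only [value]
      rw [hD.eval_eq_sum_frontier y le_rfl (by omega)]
      -- Frontier nodes that are not below `u` have zero quotient, so the children may be restricted
      -- to those below `u`.
      refine (Finset.sum_subset (fun t ht => ?_) fun t ht ht' => ?_).symm
      · exact Finset.mem_filter.2 ⟨Finset.mem_univ t, (Finset.mem_filter.1 ht).2.2⟩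
      · rw [quotient_of_not_below, zero_mul]
        exact fun htu => ht' (Finset.mem_filter.2
          ⟨Finset.mem_univ t, htu, (Finset.mem_filter.1 ht).2⟩)

theorem isValidNode_quot (hC : C.IsMonotone) (hD : C.IsScopeFunction Sigma.fst D) {u v : C.V}
    (hvu : C.Below v u) (hv : (D v).Nonempty) :
    IsValidNode (label C D) (children C D) (scope D) (value C) (quot u v) := by
  classical
  by_cases hu : (D u).card ≤ (D v).card
  · have h0 : D u = D v := (Finset.eq_of_subset_of_card_le (hD.subset_of_below hvu) hu).symm
    exact Or.inr <| Or.inl ⟨C.quotient 0 v u, by rw [label, if_pos hu], by rw [children, if_pos hu],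
      by simp [scope, h0], quotient_nonneg hC (fun _ => le_rfl) v u,
      fun y => hD.quotient_eq_of_eq y 0 h0⟩
  · refine Or.inr <| Or.inr <| Or.inl ⟨by rw [label, if_neg hu], ?_, ?_, fun y => ?_⟩ <;>
      rw [children, if_neg hu]
    · obtain ⟨t, ht⟩ := hD.exists_isFrontierAbove (k := (D u).card + (D v).card) hvu
        (by omega) (by omega)
      exact ⟨_, Finset.mem_image_of_mem _ (Finset.mem_filter.2 ⟨Finset.mem_univ t, ht⟩)⟩
    · intro c hc
      obtain ⟨t, -, rfl⟩ := Finset.mem_image.1 hc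
      rfl
    · rw [Finset.sum_image fun a _ b _ h => by simpa using h]
      simp only [value]
      rw [hD.quotient_eq_sum_frontier y (k := (D u).card + (D v).card) hv (by omega) hvu
        (by omega)]
      refine (Finset.sum_subset (fun t ht => ?_) fun t ht ht' => ?_).symm
      · exact Finset.mem_filter.2 ⟨Finset.mem_univ t, (Finset.mem_filter.1 ht).2.2⟩
      · rw [quotient_of_not_below, zero_mul]
        exact fun htu => ht' (Finset.mem_filter.2
          ⟨Finset.mem_univ t, htu, (Finset.mem_filter.1 ht).2⟩)

theorem isValidNode_nodeProd (hD : C.IsScopeFunction Sigma.fst D) {u t : C.V}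
    (htu : C.Below t u) (ht : C.IsFrontier D (D u).card t) :
    IsValidNode (label C D) (children C D) (scope D) (value C) (nodeProd u t) := by
  classical
  refine Or.inr <| Or.inr <| Or.inr ⟨rfl, Finset.insert_nonempty _ _, ?_⟩
  rw [children]
  have hsub := hD.subset_of_below htu
  rcases label_eq_of_isFrontier hD ht with hl | ⟨i, hl⟩
  · rw [if_pos hl]
    have hdisj : ∀ c ∈ C.children t, Disjoint (D u \ D t) (D c) := fun c hc =>
      Finset.sdiff_disjoint.mono_right (hD.subset_of_mem hc)
    refine ⟨?_, ?_, fun y => ?_⟩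
    · rw [Finset.biUnion_insert, Finset.image_biUnion]
      simp only [scope]
      rw [← hD.prod t hl, Finset.sdiff_union_of_subset hsub]
    · intro a ha b hb hab
      simp only [Finset.mem_insert, Finset.mem_image] at ha hb
      rcases ha with rfl | ⟨c, hc, rfl⟩ <;> rcases hb with rfl | ⟨d, hd, rfl⟩
      · exact absurd rfl hab
      · exact hdisj d hd
      · exact (hdisj c hc).symm
      · exact hD.disjoint t hl c hc d hd fun h => hab (h ▸ rfl)
    · rw [Finset.prod_insert (by simp), Finset.prod_image fun a _ b _ h => by simpa using h]
      simp only [value]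
      rw [eval_prod y hl]
  · rw [if_neg (by simp [hl])]
    refine ⟨?_, ?_, fun y => ?_⟩
    · rw [Finset.biUnion_insert, Finset.singleton_biUnion]
      simp only [scope]
      rw [Finset.sdiff_union_of_subset hsub]
    · intro a ha b hb hab
      simp only [Finset.mem_insert, Finset.mem_singleton] at ha hb
      rcases ha with rfl | rfl <;> rcases hb with rfl | rfl
      · exact absurd rfl hab
      · exact Finset.sdiff_disjoint
      · exact Finset.sdiff_disjoint.symm
      · exact absurd rfl hab
    · rw [Finset.prod_insert (by simp), Finset.prod_singleton]
      simp only [value]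

/-- The quotient at the product `t` keeps `v` in one factor, and removing `D v` from every child's
scope changes only that factor. With `D u \ D t` this partitions `D u \ D v`. -/
theorem isValidNode_quotProd (hD : C.IsScopeFunction Sigma.fst D) {u v t : C.V}
    (htu : C.Below t u) (hv : (D v).Nonempty)
    (ht : C.IsFrontierAbove D v ((D u).card + (D v).card) t) :
    IsValidNode (label C D) (children C D) (scope D) (value C) (quotProd u v t) := by
  classical
  obtain ⟨hl, hvt, htk, -⟩ := ht
  refine Or.inr <| Or.inr <| Or.inr ⟨rfl, Finset.insert_nonempty _ _, ?_⟩
  rw [children]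
  have htv : t ≠ v := by
    rintro rfl
    have := hD.card_le_of_below htu
    omega
  obtain ⟨c₀, hc₀, hvc₀⟩ := hvt.eq_or_exists.resolve_left htv
  set f : C.V → BalancedNode C.V := fun c => if C.Below v c then quot c v else node c with hf
  have hfsub : ∀ c, scope D (f c) ⊆ D c := by
    intro c
    simp only [hf]
    split_ifs
    · exact Finset.sdiff_subset
    · exact subset_rfl
  have hfv : ∀ c ∈ C.children t, scope D (f c) = D c \ D v := by
    intro c hc
    simp only [hf]
    split_ifs with hvc
    · rfl
    · refine (Finset.sdiff_eq_self_of_disjoint ?_).symm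
      exact (hD.disjoint t hl c hc c₀ hc₀ (by rintro rfl; exact hvc hvc₀)).mono_right
        (hD.subset_of_below hvc₀)
  -- Children form a set, so coinciding factors would be counted once. Injectivity of `f`, and `t ≠
  -- v` for the extra factor `quot u t`, rule this out.
  have hinj : Function.Injective f := by
    intro a b hab
    simp only [hf] at hab
    split_ifs at hab <;> simpa using hab
  have hnot : quot u t ∉ (C.children t).image f := by
    intro h
    obtain ⟨c, -, hc⟩ := Finset.mem_image.1 h
    simp only [hf] at hc
    split_ifs at hc
    exact htv (quot.inj hc).2.symm
  have hdisj : ∀ c ∈ C.children t, Disjoint (D u \ D t) (scope D (f c)) := fun c hc =>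
    Finset.sdiff_disjoint.mono_right ((hfsub c).trans (hD.subset_of_mem hc))
  refine ⟨?_, ?_, fun y => ?_⟩
  · rw [Finset.biUnion_insert, Finset.image_biUnion, Finset.biUnion_congr rfl hfv]
    ext x
    have hvx : x ∈ D v → x ∈ D t := fun h => hD.subset_of_below hvt h
    have htx : x ∈ D t → x ∈ D u := fun h => hD.subset_of_below htu h
    have hx : x ∈ D t ↔ ∃ c ∈ C.children t, x ∈ D c := by
      conv_lhs => rw [hD.prod t hl]
      exact Finset.mem_biUnion
    simp only [scope, Finset.mem_union, Finset.mem_sdiff, Finset.mem_biUnion]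
    have hx' : (∃ c ∈ C.children t, x ∈ D c ∧ x ∉ D v) ↔ x ∈ D t ∧ x ∉ D v := by
      rw [hx]
      exact ⟨fun ⟨c, h1, h2, h3⟩ => ⟨⟨c, h1, h2⟩, h3⟩, fun ⟨⟨c, h1, h2⟩, h3⟩ => ⟨c, h1, h2, h3⟩⟩
    rw [hx']
    tauto
  · intro a ha b hb hab
    simp only [Finset.mem_insert, Finset.mem_image] at ha hb
    rcases ha with rfl | ⟨c, hc, rfl⟩ <;> rcases hb with rfl | ⟨d, hd, rfl⟩
    · exact absurd rfl hab
    · exact hdisj d hd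
    · exact (hdisj c hc).symm
    · exact (hD.disjoint t hl c hc d hd fun h => hab (h ▸ rfl)).mono (hfsub c) (hfsub d)
  · rw [Finset.prod_insert hnot, Finset.prod_image hinj.injOn]
    simp only [value]
    rw [quotient_prod y hl htv hvt]
    congr 1
    refine Finset.prod_congr rfl fun c _ => ?_
    simp only [hf]
    split_ifs <;> rfl

theorem isValidNode_of_isUsed (hC : C.IsMonotone) (hD : C.IsScopeFunction Sigma.fst D)
    (b : BalancedNode C.V) (hb : IsUsed C D b) :
    IsValidNode (label C D) (children C D) (scope D) (value C) b := by
  cases b with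
  | node u => exact isValidNode_node hC hD u
  | leaf u =>
    obtain ⟨i, hi⟩ := hb
    exact Or.inl ⟨i, hi, rfl, hD.var u i hi, fun y => eval_var y hi⟩
  | quot u v => exact isValidNode_quot hC hD hb.1 hb.2
  | nodeProd u t => exact isValidNode_nodeProd hD hb.1 hb.2
  | quotProd u v t => exact isValidNode_quotProd hD hb.1 hb.2.1 hb.2.2

end BalancedNode

/-! ### The balanced SPN -/

namespace SPN

/-- Every D&C SPN can be balanced. -/
theorem IsDC.exists_balanced {n : ℕ} {F : UnivariateData n} {Φ : SPN F} (h : Φ.IsDC) :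
    ∃ Φ' : SPN F, Φ'.IsDC ∧ (∀ y, Φ'.output y = Φ.output y) ∧ Φ'.size ≤ 5 * Φ.size ^ 3 ∧
      Φ'.depth ≤ 4 * n.size + 1 := by
  classical
  have hD := h.isScopeFunction
  obtain ⟨Φ', h1, h2, h3, h4⟩ := exists_of_isValidNode _ _ _ _ _ _
    (BalancedNode.node Φ.root) trivial (BalancedNode.isUsed_and_rank_lt hD)
    (BalancedNode.isValidNode_of_isUsed Φ.monotone hD)
  refine ⟨Φ', h1, h2, h3.trans ?_, h4.trans ?_⟩
  · rw [ArithmeticCircuit.size, ← Nat.card_eq_fintype_card]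
    exact BalancedNode.card_le
  · have : Nat.size (Finset.card {x | x ∈ Φ.dependencyScope Φ.root}) ≤ n.size :=
      Nat.size_le_size ((Finset.card_le_univ _).trans_eq (Fintype.card_fin n))
    simp only [BalancedNode.rank]
    omega

theorem size_pos {n : ℕ} {F : UnivariateData n} (Φ : SPN F) : 0 < Φ.size :=
  Fintype.card_pos_iff.2 ⟨Φ.root⟩

theorem depth_lt_size {n : ℕ} {F : UnivariateData n} (Φ : SPN F) : Φ.depth < Φ.size := by
  obtain ⟨p, hp, hlen⟩ := Φ.isGreatest_depth.1
  have h1 : p.IsChain (Relation.TransGen Φ.Edge) := hp.imp fun _ _ h => Relation.TransGen.single h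
  have h2 : p.Nodup := h1.pairwise.imp fun {a b} h => by
    rintro rfl
    exact Φ.acyclic a h
  have := h2.length_le_card
  rw [ArithmeticCircuit.size]
  omega

end SPN

/-! ### Logarithmic bounds and asymptotics -/

/-- The bit length is at most log₂ n + 1, and 1 ≤ log₂ n. -/
theorem natSize_mul_log_two_le {n : ℕ} (hn : 2 ≤ n) : n.size * Real.log 2 ≤ 2 * Real.log n := by
  have h1 : 0 < n.size := Nat.size_pos.2 (by omega)
  have h2 : 2 ^ (n.size - 1) ≤ n := Nat.lt_size.1 (by omega)
  have h3 : (2 : ℝ) ^ (n.size - 1) ≤ n := by exact_mod_cast h2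
  have h4 := Real.log_le_log (by positivity) h3
  rw [Real.log_pow, Nat.cast_sub (by omega), Nat.cast_one] at h4
  have h5 : Real.log 2 ≤ Real.log n := Real.log_le_log (by norm_num) (by exact_mod_cast hn)
  linarith

theorem exists_depth_reduction : ∃ C : ℝ, 0 ≤ C ∧ ∀ (n : ℕ), 2 ≤ n →
    ∀ (F : UnivariateData n) (Φ : SPN F), Φ.IsDC →
      ∃ Φ' : SPN F, Φ'.IsDC ∧ (∀ y : F.Idx → ℝ, Φ'.output y = Φ.output y) ∧
        (Φ'.size : ℝ) ≤ C * (Φ.size : ℝ) ^ 3 ∧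
        (Φ'.depth : ℝ) ≤ C * (Real.log n * Real.log Φ.size) := by
  have hl2 : 0 < Real.log 2 := Real.log_pos (by norm_num)
  have hl2' : Real.log 2 ≤ 1 := by linarith [Real.log_two_lt_d9]
  -- One factor log 2 converts the bit length of `n` to log n, where 4 · 2 + 1 ≤ 10; the other comes
  -- from log 2 ≤ log s.
  refine ⟨10 / Real.log 2 ^ 2, by positivity, fun n hn F Φ hΦ => ?_⟩
  have hC : 5 ≤ 10 / Real.log 2 ^ 2 := by
    rw [le_div_iff₀ (by positivity)]
    nlinarith
  -- For size 1 the bound on the depth is zero, and only the original one-node circuit will do.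
  rcases Nat.lt_or_ge Φ.size 2 with hs | hs
  · have hs1 : Φ.size = 1 := by
      have := Φ.size_pos
      omega
    have hd : Φ.depth = 0 := by
      have := Φ.depth_lt_size
      omega
    refine ⟨Φ, hΦ, fun _ => rfl, ?_, ?_⟩
    · rw [hs1]
      norm_num
      linarith
    · simp [hs1, hd]
  · obtain ⟨Φ', h1, h2, h3, h4⟩ := hΦ.exists_balanced
    refine ⟨Φ', h1, h2, ?_, ?_⟩
    · calc (Φ'.size : ℝ) ≤ 5 * (Φ.size : ℝ) ^ 3 := by exact_mod_cast h3
        _ ≤ _ := mul_le_mul_of_nonneg_right hC (by positivity)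
    · have hs' : Real.log 2 ≤ Real.log Φ.size :=
        Real.log_le_log (by norm_num) (by exact_mod_cast hs)
      have hn' : Real.log 2 ≤ Real.log n := Real.log_le_log (by norm_num) (by exact_mod_cast hn)
      have h5 : (Φ'.depth : ℝ) ≤ 4 * n.size + 1 := by exact_mod_cast h4
      have h6 := natSize_mul_log_two_le hn
      have h7 : (Φ'.depth : ℝ) * Real.log 2 ≤ 10 * Real.log n := by nlinarith
      rw [div_mul_eq_mul_div, le_div_iff₀ (by positivity)]
      calc (Φ'.depth : ℝ) * Real.log 2 ^ 2 = Φ'.depth * Real.log 2 * Real.log 2 := by ring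
        _ ≤ 10 * Real.log n * Real.log Φ.size := mul_le_mul h7 hs' hl2.le (by linarith)
        _ = _ := by ring

open Asymptotics Filter in
theorem isBigO_log_of_isBigO_pow {s : ℕ → ℕ} (hs : ∀ n, 0 < s n) {k : ℕ}
    (h : (fun n => (s n : ℝ)) =O[atTop] fun n : ℕ => (n : ℝ) ^ k) :
    (fun n => Real.log (s n)) =O[atTop] fun n : ℕ => Real.log n := by
  obtain ⟨K, hK, h⟩ := h.exists_pos
  have hl2 : 0 < Real.log 2 := Real.log_pos (by norm_num)
  refine IsBigO.of_bound (|Real.log K| / Real.log 2 + k) ?_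
  filter_upwards [h.bound, eventually_ge_atTop 2] with n hn hn2
  have hn' : Real.log 2 ≤ Real.log n := Real.log_le_log (by norm_num) (by exact_mod_cast hn2)
  have hn0 : (0 : ℝ) < n := by
    have : 0 < n := by omega
    exact_mod_cast this
  have hs0 : (1 : ℝ) ≤ s n := by exact_mod_cast hs n
  rw [Real.norm_of_nonneg (by positivity), Real.norm_of_nonneg (by positivity)] at hn
  have h1 := Real.log_le_log (by positivity) hn
  rw [Real.log_mul hK.ne' (by positivity), Real.log_pow] at h1
  rw [Real.norm_of_nonneg (Real.log_nonneg hs0), Real.norm_of_nonneg (hl2.le.trans hn')]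
  -- The additive constant log K is absorbed through log n ≥ log 2.
  have h2 : |Real.log K| ≤ |Real.log K| / Real.log 2 * Real.log n := by
    rw [div_mul_eq_mul_div, le_div_iff₀ hl2]
    exact mul_le_mul_of_nonneg_left hn' (abs_nonneg _)
  have h3 := le_abs_self (Real.log K)
  rw [add_mul]
  linarith

open Asymptotics Filter in
theorem IsPolySizeDCFamily.exists_depth_isBigO {F : (n : ℕ) → UnivariateData n}
    {g : (n : ℕ) → (F n).Point → ℝ} {Φ : (n : ℕ) → SPN (F n)} (h : IsPolySizeDCFamily F g Φ) :
    ∃ Φ : (n : ℕ) → SPN (F n), IsPolySizeDCFamily F g Φ ∧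
      (fun n => ((Φ n).depth : ℝ)) =O[atTop] fun n => Real.log (n : ℝ) ^ 2 := by
  obtain ⟨C, hC, hred⟩ := exists_depth_reduction
  have hex : ∀ n, ∃ Ψ : SPN (F n), Ψ.IsDC ∧ (∀ x, Ψ.value x = g n x) ∧
      (2 ≤ n → (Ψ.size : ℝ) ≤ C * ((Φ n).size : ℝ) ^ 3 ∧
        (Ψ.depth : ℝ) ≤ C * (Real.log n * Real.log (Φ n).size)) := by
    intro n
    by_cases hn : 2 ≤ n
    · obtain ⟨Ψ, h1, h2, h3⟩ := hred n hn (F n) (Φ n) (h.1 n).1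
      exact ⟨Ψ, h1, fun x => (h2 _).trans ((h.1 n).2 x), fun _ => h3⟩
    -- For `n < 2` the original circuit is kept, as finitely many `n` do not affect the asymptotics.
    · exact ⟨Φ n, (h.1 n).1, (h.1 n).2, fun h => absurd h hn⟩
  choose Ψ hΨ hval hbound using hex
  obtain ⟨k, hk⟩ := h.2
  refine ⟨Ψ, ⟨fun n => ⟨hΨ n, hval n⟩, k * 3, ?_⟩, ?_⟩
  · have h1 : (fun n => ((Ψ n).size : ℝ)) =O[atTop] fun n => ((Φ n).size : ℝ) ^ 3 := by
      refine IsBigO.of_bound C ?_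
      filter_upwards [eventually_ge_atTop 2] with n hn
      rw [Real.norm_of_nonneg (by positivity), Real.norm_of_nonneg (by positivity)]
      exact (hbound n hn).1
    refine h1.trans ?_
    simpa only [pow_mul] using hk.pow 3
  · have h1 : (fun n => ((Ψ n).depth : ℝ)) =O[atTop]
        fun n => Real.log n * Real.log (Φ n).size := by
      refine IsBigO.of_bound C ?_
      filter_upwards [eventually_ge_atTop 2] with n hn
      rw [Real.norm_of_nonneg (by positivity)]
      exact (hbound n hn).2.trans (mul_le_mul_of_nonneg_left (le_abs_self _) hC)
    refine h1.trans ?_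
    simp only [pow_two]
    exact (isBigO_refl _ _).mul (isBigO_log_of_isBigO_pow (fun n => (Φ n).size_pos) hk)

theorem mainTheorem6 :
    (∃ C : ℝ, ∀ (n : ℕ), 2 ≤ n → ∀ (F : UnivariateData n) (Φ : SPN F), Φ.IsDC →
      ∃ Φ' : SPN F, Φ'.IsDC ∧
        (∀ y : F.Idx → ℝ, Φ'.output y = Φ.output y) ∧
        (∀ x : F.Point, Φ'.value x = Φ.value x) ∧
        (Φ'.size : ℝ) ≤ C * (Φ.size : ℝ) ^ 3 ∧
        (Φ'.depth : ℝ) ≤ C * (Real.log n * Real.log Φ.size)) ∧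
    (∀ (F : (n : ℕ) → UnivariateData n) (g : (n : ℕ) → (F n).Point → ℝ),
      (∃ Φ : (n : ℕ) → SPN (F n), IsPolySizeDCFamily F g Φ) ↔
        ∃ Φ : (n : ℕ) → SPN (F n), IsPolySizeDCFamily F g Φ ∧
          Asymptotics.IsBigO Filter.atTop (fun n => ((Φ n).depth : ℝ))
            (fun n => Real.log (n : ℝ) ^ 2)) := by
  constructor
  · obtain ⟨C, -, hC⟩ := exists_depth_reduction
    refine ⟨C, fun n hn F Φ hΦ => ?_⟩
    obtain ⟨Φ', h1, h2, h3⟩ := hC n hn F Φ hΦ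
    exact ⟨Φ', h1, h2, fun x => h2 _, h3⟩
  · intro F g
    constructor
    · rintro ⟨Φ, hΦ⟩
      exact hΦ.exists_depth_isBigO
    · rintro ⟨Φ, hΦ, -⟩
      exact ⟨Φ, hΦ⟩
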